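/- Let $q\ge 1$ and $b\ge 1$ be integers, let $\Sigma_q=\{0,1,\dots,q-1\}$, and for $n\ge 2b+1$ and $\mathbf{x}\in\Sigma_q^n$ let $\mathcal{L}_1^b(\mathbf{x})\subseteq\Sigma_q^n$ be the fixed-length $b$-burst Levenshtein ball of radius one: the set of all sequences obtained from $\mathbf{x}$ by deleting $b$ consecutive entries and then inserting a block of $b$ consecutive arbitrary symbols of $\Sigma_q$ at an arbitrary position. Let $\mathbf{x}$ be uniformly distributed on $\Sigma_q^n$. Then for every $n\ge 2b+1$ $$\mathbb{E}\big[|\mathcal{L}_1^b(\mathbf{x})|\big]=q^{b-2}\big(q+(q-1)(n-b)\big)\big((n-b+1)(q-1)-1\big)+2q^{b-1}-\sum_{j=1}^{b-1}\frac{q^b(q-1)^2(n-b-j)}{q^{j+3}}-\sum_{i=1}^{n-2b}\;\sum_{j=i+b}^{n-b}\frac{k_{i,j}}{q^{\,j+b-i+1}},$$ where $k_{i,j}=(q-1)q^{2b-1}$ if $b\mid (j-i)$ and $k_{i,j}=(q-1)^2q^{2b-2}$ otherwise. Moreover, for fixed $q$ and $b$, $$\mathbb{E}\big[|\mathcal{L}_1^b(\mathbf{x})|\big]=q^{b-2}(q-1)^2n^2+O(n),$$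 that is, there is a constant $C$ depending only on $q$ and $b$ such that $\big|\mathbb{E}[|\mathcal{L}_1^b(\mathbf{x})|]-q^{b-2}(q-1)^2n^2\big|\le Cn$ for all $n\ge 2b+1$. -/

import Mathlib

/-- `y` arises from the sequence `x` by one burst of `b` deletions:
`b` consecutive entries of `x` are removed. -/
def IsBurstDeletion {α : Type} (b : ℕ) (x y : List α) : Prop :=
  ∃ u v w : List α, v.length = b ∧ x = u ++ v ++ w ∧ y = u ++ w

/-- `z` arises from the sequence `y` by one burst of `b` insertions:
a block of `b` consecutive arbitrary entries is inserted somewhere in `y`. -/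
def IsBurstInsertion {α : Type} (b : ℕ) (y z : List α) : Prop :=
  ∃ u v w : List α, v.length = b ∧ y = u ++ w ∧ z = u ++ v ++ w

/-- The fixed-length `b`-burst Levenshtein ball of radius one centred at `x ∈ Σ_q^n`: all
`z ∈ Σ_q^n` obtained from `x` by one burst of `b` deletions followed by one burst of
`b` insertions. -/
def burstLevenshteinBall {q n : ℕ} (b : ℕ) (x : Fin n → Fin q) : Set (Fin n → Fin q) :=
  {z | ∃ y : List (Fin q),
    IsBurstDeletion b (List.ofFn x) y ∧ IsBurstInsertion b y (List.ofFn z)}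

/-- The expected size of the radius-one ball when its centre is uniform on `Σ_q^n`. -/
noncomputable def expectedBallSize (q b n : ℕ) : ℝ :=
  (∑ x : Fin n → Fin q, ((burstLevenshteinBall b x).ncard : ℝ)) / (q : ℝ) ^ n

/-- The weights `k_{i,j}` (used for `i ≤ j` and `b ≥ 1` only). -/
noncomputable def pairWeight (q b i j : ℕ) : ℝ :=
  if b ∣ j - i then ((q : ℝ) - 1) * (q : ℝ) ^ (2 * b - 1)
  else ((q : ℝ) - 1) ^ 2 * (q : ℝ) ^ (2 * b - 2)

/-! Put `m = n - b`. The total size of the balls is the number of pairs `(x, z)` that have a common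
result of a burst deletion, from `x` at `i` and from `z` at `j`. This means that the two sequences
agree outside a window of length at least `b`, and that inside it one is the shift of the other by
`b` (`mem_burstLevenshteinBall_iff`). The window can be shrunk to run from the first difference `a`
to the last difference `c`, as long as these are at least `b` apart.

Hence the pairs split disjointly (`ballPairs_eq`): all differences in the last `b` places; `a < m`
and `c < a + b`, with no further condition; `a < m` and `c = a + b + t`, with a shift in one of the
two directions. Each class is counted column by column from left to right
(`card_eq_prod_of_forall_prefix`). In the last class inclusion-exclusion gives twice the number of
shifts minus the number of pairs that are shifts both ways. In the latter the columns repeat with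
period `b` up to swapping, so a difference at `c` amounts to one at `a + t % b`; this is where the
case `b ∣ t` comes from.

After division by `q ^ n` the counts depend on `t` only (`expectedBallSize_eq`). Splitting the
correction sum at `t = 0`, `0 < t < b` and `t ≥ b` gives the stated formula; a geometric series
bounds the whole correction by `m * q ^ b`, which gives the asymptotics. -/

/-! ### Membership in the ball as a shift on a window. -/

/-- Optional lookup makes one formula cover every index: past the end both sides are `none`, which
also fixes the length of `y`. -/
theorem isBurstDeletion_iff {α : Type} (b : ℕ) (l y : List α) :
    IsBurstDeletion b l y ↔ ∃ i, i + b ≤ l.length ∧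
      ∀ k : ℕ, y[k]? = if k < i then l[k]? else l[k + b]? := by
  constructor
  · rintro ⟨u, v, w, hv, rfl, rfl⟩
    refine ⟨u.length, by simp; omega, fun k => ?_⟩
    split_ifs with h
    · rw [List.append_assoc, List.getElem?_append_left h, List.getElem?_append_left h]
    · rw [List.getElem?_append_right (by omega), List.getElem?_append_right (by simp; omega)]
      congr 1
      simp
      omega
  · rintro ⟨i, hi, hy⟩
    refine ⟨l.take i, (l.drop i).take b, (l.drop i).drop b, by simp; omega, by simp, ?_⟩
    apply List.ext_getElem?
    intro k
    rw [hy]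
    split_ifs with h
    · rw [List.getElem?_append_left (by simp; omega), List.getElem?_take_of_lt h]
    · rw [List.getElem?_append_right (by simp; omega)]
      simp only [List.length_take, List.getElem?_drop]
      congr 1
      omega

theorem isBurstInsertion_iff {α : Type} (b : ℕ) (y z : List α) :
    IsBurstInsertion b y z ↔ IsBurstDeletion b z y := by
  simp only [IsBurstInsertion, IsBurstDeletion]
  constructor
  · rintro ⟨u, v, w, h, h', h''⟩
    exact ⟨u, v, w, h, h'', h'⟩
  · rintro ⟨u, v, w, h, h', h''⟩
    exact ⟨u, v, w, h, h'', h'⟩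

theorem exists_common_burstDeletion_iff {α : Type} (b : ℕ) (l l' : List α) :
    (∃ y, IsBurstDeletion b l y ∧ IsBurstInsertion b y l') ↔
      ∃ i j, i + b ≤ l.length ∧ j + b ≤ l'.length ∧ ∀ k : ℕ,
        (if k < i then l[k]? else l[k + b]?) = if k < j then l'[k]? else l'[k + b]? := by
  simp only [isBurstInsertion_iff, isBurstDeletion_iff]
  constructor
  · rintro ⟨y, ⟨i, hi, h⟩, ⟨j, hj, h'⟩⟩
    exact ⟨i, j, hi, hj, fun k => by rw [← h, ← h']⟩
  · rintro ⟨i, j, hi, hj, h⟩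
    obtain ⟨i', hi', y, hy⟩ : ∃ i' y, i' = i ∧ ∀ k : ℕ,
        y[k]? = if k < i then l[k]? else l[k + b]? := by
      refine ⟨i, l.take i ++ l.drop (i + b), rfl, fun k => ?_⟩
      split_ifs with h
      · rw [List.getElem?_append_left (by simp; omega), List.getElem?_take_of_lt h]
      · rw [List.getElem?_append_right (by simp; omega)]
        simp only [List.length_take, List.getElem?_drop]
        congr 1
        omega
    exact ⟨hi', ⟨i, hi, hy⟩, j, hj, fun k => by rw [hy, h]⟩

/-- The sequences `x` and `z` agree outside `[i, e)`, and inside this window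
`z` is `x` shifted by `b` places to the left. -/
def BurstShift {α : Type} {n : ℕ} (b i e : ℕ) (x z : Fin n → α) : Prop :=
  (∀ k : Fin n, (k : ℕ) < i ∨ e ≤ k → x k = z k) ∧
    ∀ k l : Fin n, (k : ℕ) + b = l → i ≤ k → (l : ℕ) < e → x l = z k

/-- Both shortened sequences read the originals in place before `i` and `b` places later from `j`
on, which is agreement outside the window; between `i` and `j` only `x` is read `b` places later,
which is the shift. -/
theorem burstShift_iff {α : Type} {n : ℕ} {b i j : ℕ} (hij : i ≤ j) (hj : j + b ≤ n)
    (x z : Fin n → α) :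
    (∀ k : ℕ, (if k < i then (List.ofFn x)[k]? else (List.ofFn x)[k + b]?) =
      if k < j then (List.ofFn z)[k]? else (List.ofFn z)[k + b]?) ↔
      BurstShift b i (j + b) x z := by
  constructor
  · intro h
    refine ⟨fun k hk => ?_, fun k l hkl hik hl => ?_⟩
    · rcases hk with hk | hk
      · have := h k
        rw [if_pos hk, if_pos (by omega)] at this
        simpa using this
      -- Since `j + b ≤ k`, index `k - b` is past both deletion points, so both sides read the entry
      -- at `k`.
      · have := h (k - b)
        rw [if_neg (by omega), if_neg (by omega), Nat.sub_add_cancel (by omega)] at this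
        simpa using this
    · have := h k
      rw [if_neg (by omega), if_pos (by omega), hkl] at this
      simpa using this
  · rintro ⟨h, h'⟩ k
    split_ifs with h1 h2 h2
    · have hk : k < n := by omega
      simpa [List.getElem?_ofFn, hk] using h ⟨k, hk⟩ (Or.inl h1)
    · omega
    · have hk : k < n := by omega
      have hk' : k + b < n := by omega
      simpa [List.getElem?_ofFn, hk, hk'] using
        h' ⟨k, hk⟩ ⟨k + b, hk'⟩ rfl (by simpa using h1) (by simpa using h2)
    · by_cases hk' : k + b < n
      · simpa [List.getElem?_ofFn, hk'] using h ⟨k + b, hk'⟩ (Or.inr (by simp; omega))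
      · simp [hk']

theorem mem_burstLevenshteinBall_iff {q n : ℕ} (b : ℕ) (x z : Fin n → Fin q) :
    z ∈ burstLevenshteinBall b x ↔
      ∃ i e, i + b ≤ e ∧ e ≤ n ∧ (BurstShift b i e x z ∨ BurstShift b i e z x) := by
  rw [burstLevenshteinBall, Set.mem_ofPred_eq, exists_common_burstDeletion_iff]
  simp only [List.length_ofFn]
  constructor
  · rintro ⟨i, j, hi, hj, h⟩
    -- The order of the two deletion points decides which sequence is the shift of the other.
    rcases le_total i j with hij | hij
    · exact ⟨i, j + b, by omega, hj, Or.inl ((burstShift_iff hij hj x z).1 h)⟩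
    · exact ⟨j, i + b, by omega, hi, Or.inr ((burstShift_iff hij hi z x).1 fun k => (h k).symm)⟩
  · rintro ⟨i, e, hie, he, h⟩
    obtain ⟨j, rfl⟩ : ∃ j, e = j + b := ⟨e - b, by omega⟩
    rcases h with h | h
    · exact ⟨i, j, by omega, he, (burstShift_iff (by omega) he x z).2 h⟩
    · exact ⟨j, i, he, by omega, fun k => ((burstShift_iff (by omega) he z x).2 h k).symm⟩

/-! ### Counting by successive choices of letters. -/

open Classical in
/-- If each prefix of length `k` can be continued by an admissible letter in exactly `d k` ways,
there are `∏ d k` admissible sequences. -/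
theorem card_eq_prod_of_forall_prefix {β : Type} [Fintype β] (C : (k : ℕ) → (Fin k → β) → β → Prop)
    (d : ℕ → ℕ) (n : ℕ)
    (h : ∀ k < n, ∀ g : Fin k → β, (Finset.univ.filter (C k g)).card = d k)
    (S : Finset (Fin n → β))
    (hS : ∀ p, p ∈ S ↔ ∀ k : Fin n, C k (fun i => p (Fin.castLE k.2.le i)) (p k)) :
    S.card = ∏ k ∈ Finset.range n, d k := by
  obtain rfl : S = Finset.univ.filter fun p : Fin n → β =>
      ∀ k : Fin n, C k (fun i => p (Fin.castLE k.2.le i)) (p k) := by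
    ext p
    simp [hS]
  clear hS
  induction n with
  | zero => simp
  | succ n ih =>
    rw [Finset.prod_range_succ, ← ih fun k hk => h k (by omega), ← smul_eq_mul,
      ← Finset.sum_const, ← Finset.sum_congr rfl fun p _ => h n (by omega) p, ← Finset.card_sigma]
    refine Finset.card_nbij' (fun p => ⟨Fin.init p, p (Fin.last n)⟩) (fun s => Fin.snoc s.1 s.2)
      ?_ ?_ ?_ ?_
    · intro p hp
      simp only [Finset.coe_filter, Finset.mem_univ, true_and, Set.mem_ofPred_eq,
        Finset.coe_sigma, Set.mem_sigma_iff] at hp ⊢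
      exact ⟨fun k => hp k.castSucc, hp (Fin.last n)⟩
    · intro s hs
      simp only [Finset.coe_filter, Finset.mem_univ, true_and, Set.mem_ofPred_eq,
        Finset.coe_sigma, Set.mem_sigma_iff] at hs ⊢
      intro k
      have key : ∀ (k : ℕ) (hk : k ≤ n) (hk' : k ≤ n + 1),
          (fun i : Fin k => (Fin.snoc s.1 s.2 : Fin (n + 1) → β) (Fin.castLE hk' i)) =
            fun i => s.1 (Fin.castLE hk i) := by
        intro k hk hk'
        funext i
        exact Fin.snoc_castSucc (α := fun _ => β) s.2 s.1 (Fin.castLE hk i)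
      refine Fin.lastCases ?_ (fun k => ?_) k
      · have := hs.2
        rw [Fin.snoc_last]
        rw [key (Fin.last n) le_rfl]
        exact this
      · have := hs.1 k
        rw [Fin.snoc_castSucc]
        rw [key k.castSucc k.2.le]
        exact this
    · intro p _
      simp
    · intro s _
      simp

open Classical in
theorem card_filter_fst_eq_snd (q : ℕ) :
    (Finset.univ.filter fun y : Fin q × Fin q => y.1 = y.2).card = q := by
  rw [Finset.card_nbij' (t := (Finset.univ : Finset (Fin q))) (fun y => y.1) (fun v => (v, v))]
  · simp
  · simp [Set.MapsTo]
  · simp [Set.MapsTo]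
  · rintro ⟨v, w⟩ h
    simpa using h
  · simp [Set.LeftInvOn]

open Classical in
theorem card_filter_fst_ne_snd (q : ℕ) :
    (Finset.univ.filter fun y : Fin q × Fin q => y.1 ≠ y.2).card = q * (q - 1) := by
  have h := Finset.card_filter_add_card_filter_not (s := (Finset.univ : Finset (Fin q × Fin q)))
    (fun y => y.1 = y.2)
  rw [card_filter_fst_eq_snd, Finset.card_univ, Fintype.card_prod, Fintype.card_fin] at h
  rw [Nat.mul_sub, mul_one]
  simp only [ne_eq]
  omega

open Classical in
theorem card_filter_fst_eq (q : ℕ) (v : Fin q) :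
    (Finset.univ.filter fun y : Fin q × Fin q => y.1 = v).card = q := by
  rw [Finset.card_nbij' (t := (Finset.univ : Finset (Fin q))) (fun y => y.2) (fun w => (v, w))]
  · simp
  · simp [Set.MapsTo]
  · simp [Set.MapsTo]
  · rintro ⟨v, w⟩ h
    simp at h ⊢
    exact h.symm
  · simp [Set.LeftInvOn]

open Classical in
theorem card_filter_fst_eq_and_ne_snd (q : ℕ) (v : Fin q) :
    (Finset.univ.filter fun y : Fin q × Fin q => y.1 = v ∧ y.1 ≠ y.2).card = q - 1 := by
  rw [Finset.card_nbij' (t := (Finset.univ.erase v : Finset (Fin q))) (fun y => y.2)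
    (fun w => (v, w))]
  · simp
  · rintro ⟨v', w⟩ h
    simp at h ⊢
    rintro rfl
    exact h.2 h.1
  · intro w h
    simp at h ⊢
    exact fun h' => h h'.symm
  · rintro ⟨v', w⟩ h
    simp at h ⊢
    exact h.1.symm
  · simp [Set.LeftInvOn]

open Classical in
theorem card_filter_eq_mk (q : ℕ) (v w : Fin q) :
    (Finset.univ.filter fun y : Fin q × Fin q => y.1 = v ∧ y.2 = w).card = 1 := by
  rw [Finset.card_eq_one]
  exact ⟨(v, w), by ext ⟨v', w'⟩; simp⟩

/-! ### The classes of pairs and their sizes. -/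

open Classical in
/-- The pairs of sequences that differ at `a` and agree outside `[a, a + b)`. -/
noncomputable def windowPairs (q n b a : ℕ) : Finset (Fin n → Fin q × Fin q) :=
  Finset.univ.filter fun p => ∀ k : Fin n,
    ((k : ℕ) < a ∨ a + b ≤ k → (p k).1 = (p k).2) ∧ ((k : ℕ) = a → (p k).1 ≠ (p k).2)

open Classical in
/-- The pairs of sequences that agree before `a`. -/
noncomputable def prefixPairs (q n a : ℕ) : Finset (Fin n → Fin q × Fin q) :=
  Finset.univ.filter fun p => ∀ k : Fin n, (k : ℕ) < a → (p k).1 = (p k).2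

/-- The first and the second sequence of a sequence of pairs, the second a shift of the first in
the window from `a` to `c`, where `a` and `c` are the first and the last place of difference. -/
def IsShiftPair {q n : ℕ} (b a c : ℕ) (p : Fin n → Fin q × Fin q) : Prop :=
  BurstShift b a (c + 1) (fun k => (p k).1) (fun k => (p k).2) ∧
    ∀ k : Fin n, (k : ℕ) = a ∨ (k : ℕ) = c → (p k).1 ≠ (p k).2

open Classical in
theorem card_prefixPairs (q m b : ℕ) :
    (prefixPairs q (m + b) m).card = q ^ (m + b) * q ^ b := by
  have h := card_eq_prod_of_forall_prefix (β := Fin q × Fin q)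
    (fun k _ y => k < m → y.1 = y.2) (fun k => if k < m then q else q * q) (m + b) (by
      intro k _ g
      split_ifs with h
      · simpa [h] using card_filter_fst_eq_snd q
      · simp [h]) (prefixPairs q (m + b) m) (by simp [prefixPairs])
  rw [h, Finset.prod_range_add,
    Finset.prod_congr rfl fun k hk => if_pos (Finset.mem_range.1 hk)]
  simp
  ring

open Classical in
theorem card_windowPairs (q a b r : ℕ) :
    (windowPairs q (a + (b + 1) + r) (b + 1) a).card =
      q ^ (a + (b + 1) + r) * (q ^ b * (q - 1)) := by
  have h := card_eq_prod_of_forall_prefix (β := Fin q × Fin q)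
    (fun k _ y => (k < a ∨ a + (b + 1) ≤ k → y.1 = y.2) ∧ (k = a → y.1 ≠ y.2))
    (fun k => if k < a ∨ a + (b + 1) ≤ k then q else if k = a then q * (q - 1) else q * q)
    (a + (b + 1) + r) (by
      intro k _ g
      split_ifs with h h'
      · have h' : k ≠ a := by omega
        simpa [h, h'] using card_filter_fst_eq_snd q
      · simpa [h, h'] using card_filter_fst_ne_snd q
      · simp [h, h']) (windowPairs q (a + (b + 1) + r) (b + 1) a) (by simp [windowPairs])
  have h1 : ∀ k ∈ Finset.range a, (if k < a ∨ a + (b + 1) ≤ k then q else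
      if k = a then q * (q - 1) else q * q) = q := fun k hk =>
    if_pos (Or.inl (Finset.mem_range.1 hk))
  have h2 : ∀ k ∈ Finset.range b, (if a + (k + 1) < a ∨ a + (b + 1) ≤ a + (k + 1) then q else
      if a + (k + 1) = a then q * (q - 1) else q * q) = q * q := fun k hk => by
    have := Finset.mem_range.1 hk
    rw [if_neg (by omega), if_neg (by omega)]
  rw [h, Finset.prod_range_add, Finset.prod_range_add, Finset.prod_congr rfl h1,
    Finset.prod_range_succ', Finset.prod_congr rfl h2]
  simp
  ring

open Classical in
-- The block length is `b + 1`. Columns outside the window have `q` choices, column `a` has `q * (q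
-- - 1)`, and the other `b` columns of the first block are free. In later columns the first entry is
-- forced by the column one block earlier, leaving `q` choices, or `q - 1` at the last difference.
theorem card_shiftPairs (q a b t r : ℕ) :
    (Finset.univ.filter fun p : Fin (a + (b + 1) + (t + 1) + r) → Fin q × Fin q =>
      IsShiftPair (b + 1) a (a + (b + 1) + t) p).card =
      q ^ (a + (b + 1) + t + r) * (q ^ b * (q - 1) ^ 2) := by
  have h := card_eq_prod_of_forall_prefix (β := Fin q × Fin q)
    (fun k g y => (k < a ∨ a + (b + 1) + t < k → y.1 = y.2) ∧
      (k = a ∨ k = a + (b + 1) + t → y.1 ≠ y.2) ∧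
      ∀ i : Fin k, (i : ℕ) + (b + 1) = k → a ≤ i → k ≤ a + (b + 1) + t → y.1 = (g i).2)
    (fun k => if k < a ∨ a + (b + 1) + t < k then q else if k = a then q * (q - 1) else
      if k < a + (b + 1) then q * q else if k = a + (b + 1) + t then q - 1 else q)
    (a + (b + 1) + (t + 1) + r) (by
      intro k _ g
      split_ifs with h1 h2 h3 h4
      · refine (congrArg Finset.card ?_).trans (card_filter_fst_eq_snd q)
        ext y
        simp only [Finset.mem_filter, Finset.mem_univ, true_and]
        exact ⟨fun h => h.1 h1, fun h => ⟨fun _ => h, fun _ => by omega, fun i _ _ _ => by omega⟩⟩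
      · refine (congrArg Finset.card ?_).trans (card_filter_fst_ne_snd q)
        ext y
        simp only [Finset.mem_filter, Finset.mem_univ, true_and]
        exact ⟨fun h => h.2.1 (Or.inl h2), fun h =>
          ⟨fun _ => by omega, fun _ => h, fun i _ _ _ => by omega⟩⟩
      · refine (congrArg Finset.card (?_ : _ = Finset.univ)).trans (by simp)
        ext y
        simp only [Finset.mem_filter, Finset.mem_univ, true_and, iff_true]
        exact ⟨fun _ => by omega, fun _ => by omega, fun i _ _ _ => by omega⟩
      · refine (congrArg Finset.card ?_).trans (card_filter_fst_eq_and_ne_snd q (g ⟨k - (b + 1), by omega⟩).2)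
        ext y
        simp only [Finset.mem_filter, Finset.mem_univ, true_and]
        refine ⟨fun h => ⟨h.2.2 _ (by simp; omega) (by simp; omega) (by omega), h.2.1 (Or.inr h4)⟩,
          fun h => ⟨fun _ => by omega, fun _ => h.2, fun i hi _ _ => ?_⟩⟩
        rw [h.1]
        congr 3
        omega
      · refine (congrArg Finset.card ?_).trans (card_filter_fst_eq q (g ⟨k - (b + 1), by omega⟩).2)
        ext y
        simp only [Finset.mem_filter, Finset.mem_univ, true_and]
        refine ⟨fun h => h.2.2 _ (by simp; omega) (by simp; omega) (by omega),
          fun h => ⟨fun _ => by omega, fun _ => by omega, fun i hi _ _ => ?_⟩⟩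
        rw [h]
        congr 3
        omega)
    (Finset.univ.filter fun p : Fin (a + (b + 1) + (t + 1) + r) → Fin q × Fin q =>
      IsShiftPair (b + 1) a (a + (b + 1) + t) p) (by
      intro p
      rw [Finset.mem_filter]
      simp only [IsShiftPair, BurstShift, Finset.mem_univ, true_and]
      constructor
      · rintro ⟨⟨h1, h2⟩, h3⟩ k
        exact ⟨fun hk => h1 k (by omega), h3 k,
          fun i hi hai hk => h2 (Fin.castLE k.2.le i) k hi hai (by omega)⟩
      · intro h
        exact ⟨⟨fun k hk => (h k).1 (by omega), fun k l hkl hk hl =>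
          (h l).2.2 ⟨k, by omega⟩ hkl hk (by omega)⟩, fun k => (h k).2.1⟩)
  rw [h]
  simp only [Finset.prod_range_add _ (a + (b + 1) + (t + 1)) r,
    Finset.prod_range_add _ (a + (b + 1)) (t + 1), Finset.prod_range_add _ a (b + 1)]
  rw [Finset.prod_congr rfl (g := fun _ => q) (fun k hk => by
      have := Finset.mem_range.1 hk
      rw [if_pos (by omega)]),
    Finset.prod_range_succ', Finset.prod_range_succ,
    Finset.prod_congr (s₁ := Finset.range b) rfl (g := fun _ => q * q) (fun k hk => by
      have := Finset.mem_range.1 hk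
      rw [if_neg (by omega), if_neg (by omega), if_pos (by omega)]),
    Finset.prod_congr (s₁ := Finset.range t) rfl (g := fun _ => q) (fun k hk => by
      have := Finset.mem_range.1 hk
      rw [if_neg (by omega), if_neg (by omega), if_neg (by omega), if_neg (by omega)]),
    Finset.prod_congr (s₁ := Finset.range r) rfl (g := fun _ => q) (fun k hk => by
      rw [if_pos (by omega)])]
  rw [if_neg (by omega), if_pos (by omega), if_neg (by omega), if_neg (by omega),
    if_neg (by omega), if_pos rfl]
  simp only [Finset.prod_const, Finset.card_range]
  ring

/-- Used with `j = t % (b + 1)`: the two places of the first block where a difference is required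
coincide exactly when `j = 0`. -/
theorem prod_range_ite_zero_or (b j u v : ℕ) (hj : j < b + 1) :
    (∏ k ∈ Finset.range (b + 1), if k = 0 ∨ k = j then u else v) =
      if j = 0 then u * v ^ b else u ^ 2 * v ^ (b - 1) := by
  rw [Finset.prod_range_succ']
  rcases j with _ | i
  · simp [mul_comm]
  · obtain ⟨s, rfl⟩ : ∃ s, b = i + 1 + s := ⟨b - 1 - i, by omega⟩
    rw [Finset.prod_range_add, Finset.prod_range_succ,
      Finset.prod_congr (s₁ := Finset.range i) rfl (g := fun _ => v) (fun k hk => by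
        have := Finset.mem_range.1 hk
        rw [if_neg (by omega)]),
      Finset.prod_congr (s₁ := Finset.range s) rfl (g := fun _ => v) (fun k hk => by
        rw [if_neg (by omega)]), show i + 1 + s - 1 = i + s by omega]
    simp
    ring

/-- Where each of the two sequences is a shift of the other, their differences recur
periodically. -/
theorem fst_eq_snd_iff_of_swap {q n b a c : ℕ} (p : Fin n → Fin q × Fin q)
    (h : ∀ k l : Fin n, (k : ℕ) + b = l → a ≤ k → (l : ℕ) < c + 1 →
      (p l).1 = (p k).2 ∧ (p l).2 = (p k).1)
    (k : Fin n) (hk : a ≤ k) (j : ℕ) :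
    ∀ l : Fin n, (k : ℕ) + b * j = l → (l : ℕ) < c + 1 → ((p l).1 = (p l).2 ↔
      (p k).1 = (p k).2) := by
  induction j with
  | zero =>
    intro l hl _
    obtain rfl : k = l := Fin.ext (by simpa using hl)
    rfl
  | succ j ih =>
    intro l hl hc
    have hl' : (k : ℕ) + b * j + b = l := by rw [← hl]; ring
    have := ih ⟨k + b * j, by omega⟩ rfl (by simp; omega)
    obtain ⟨h1, h2⟩ := h ⟨k + b * j, by omega⟩ l hl' (by simp; omega) hc
    rw [← this, h1, h2, eq_comm]

open Classical in
-- Every column beyond the first block is the swap of the one a block earlier, so it has a single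
-- choice. The required difference at `a + (b + 1) + t` would make that number depend on the prefix;
-- by `fst_eq_snd_iff_of_swap` it is moved a whole number of blocks back, to `a + t % (b + 1)` in
-- the first block.
theorem card_swapPairs (q a b t r : ℕ) :
    (Finset.univ.filter fun p : Fin (a + (b + 1) + (t + 1) + r) → Fin q × Fin q =>
      IsShiftPair (b + 1) a (a + (b + 1) + t) p ∧
        IsShiftPair (b + 1) a (a + (b + 1) + t) (Prod.swap ∘ p)).card =
      q ^ (a + r) * if b + 1 ∣ t then q * (q - 1) * (q * q) ^ b else
        (q * (q - 1)) ^ 2 * (q * q) ^ (b - 1) := by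
  have h := card_eq_prod_of_forall_prefix (β := Fin q × Fin q)
    (fun k g y => (k < a ∨ a + (b + 1) + t < k → y.1 = y.2) ∧
      (k = a ∨ k = a + t % (b + 1) → y.1 ≠ y.2) ∧
      ∀ i : Fin k, (i : ℕ) + (b + 1) = k → a ≤ i → k ≤ a + (b + 1) + t →
        y.1 = (g i).2 ∧ y.2 = (g i).1)
    (fun k => if k < a ∨ a + (b + 1) + t < k then q else if k < a + (b + 1) then
      if k = a ∨ k = a + t % (b + 1) then q * (q - 1) else q * q else 1)
    (a + (b + 1) + (t + 1) + r) (by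
      intro k _ g
      have ht := Nat.mod_lt t b.succ_pos
      have ht' := Nat.mod_le t (b + 1)
      simp only [Nat.succ_eq_add_one] at ht
      split_ifs with h1 h2 h3
      · refine (congrArg Finset.card ?_).trans (card_filter_fst_eq_snd q)
        ext y
        simp only [Finset.mem_filter, Finset.mem_univ, true_and]
        exact ⟨fun h => h.1 h1, fun h => ⟨fun _ => h, fun _ => by omega, fun i _ _ _ => by omega⟩⟩
      · refine (congrArg Finset.card ?_).trans (card_filter_fst_ne_snd q)
        ext y
        simp only [Finset.mem_filter, Finset.mem_univ, true_and]
        exact ⟨fun h => h.2.1 h3, fun h =>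
          ⟨fun _ => by omega, fun _ => h, fun i _ _ _ => by omega⟩⟩
      · refine (congrArg Finset.card (?_ : _ = Finset.univ)).trans (by simp)
        ext y
        simp only [Finset.mem_filter, Finset.mem_univ, true_and, iff_true]
        exact ⟨fun _ => by omega, fun _ => by omega, fun i _ _ _ => by omega⟩
      · refine (congrArg Finset.card ?_).trans (card_filter_eq_mk q (g ⟨k - (b + 1), by omega⟩).2 (g ⟨k - (b + 1), by omega⟩).1)
        ext y
        simp only [Finset.mem_filter, Finset.mem_univ, true_and]
        refine ⟨fun h => h.2.2 _ (by simp; omega) (by simp; omega) (by omega),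
          fun h => ⟨fun _ => by omega, fun _ => by omega, fun i hi _ _ => ?_⟩⟩
        rw [h.1, h.2]
        have hi' : i = ⟨k - (b + 1), by omega⟩ := Fin.ext (by simp; omega)
        rw [hi']
        exact ⟨rfl, rfl⟩)
    (Finset.univ.filter fun p : Fin (a + (b + 1) + (t + 1) + r) → Fin q × Fin q =>
      IsShiftPair (b + 1) a (a + (b + 1) + t) p ∧
        IsShiftPair (b + 1) a (a + (b + 1) + t) (Prod.swap ∘ p)) (by
      intro p
      have ht := Nat.mod_lt t b.succ_pos
      have ht' := Nat.mod_le t (b + 1)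
      simp only [Nat.succ_eq_add_one] at ht
      have hc : a + t % (b + 1) + (b + 1) * (t / (b + 1) + 1) = a + (b + 1) + t := by
        have := Nat.mod_add_div t (b + 1)
        rw [mul_add]
        omega
      rw [Finset.mem_filter]
      simp only [IsShiftPair, BurstShift, Finset.mem_univ, true_and,
        Function.comp_apply, Prod.fst_swap, Prod.snd_swap]
      constructor
      · rintro ⟨⟨⟨h1, h2⟩, h3⟩, ⟨_, h4⟩, _⟩ k
        have hp := fst_eq_snd_iff_of_swap p (b := b + 1) (a := a) (c := a + (b + 1) + t)
          fun k l hkl hk hl => ⟨h2 k l hkl hk hl, h4 k l hkl hk hl⟩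
        refine ⟨fun hk => h1 k (by omega), fun hk => ?_, fun i hi hai hk =>
          ⟨h2 (Fin.castLE k.2.le i) k hi hai (by omega),
          h4 (Fin.castLE k.2.le i) k hi hai (by omega)⟩⟩
        rcases hk with hk | hk
        · exact h3 k (Or.inl hk)
        · rw [ne_eq, ← hp k (by omega) (t / (b + 1) + 1) ⟨a + (b + 1) + t, by omega⟩
            (by rw [hk]; exact hc) (by simp)]
          exact h3 _ (Or.inr rfl)
      · intro h
        have h2 : ∀ k l : Fin (a + (b + 1) + (t + 1) + r), (k : ℕ) + (b + 1) = l → a ≤ k →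
            (l : ℕ) < a + (b + 1) + t + 1 → (p l).1 = (p k).2 ∧ (p l).2 = (p k).1 :=
          fun k l hkl hk hl => (h l).2.2 ⟨k, by omega⟩ hkl hk (by omega)
        have hp := fst_eq_snd_iff_of_swap p h2
        have h3 : ∀ k : Fin (a + (b + 1) + (t + 1) + r), (k : ℕ) = a ∨ (k : ℕ) = a + (b + 1) + t →
            (p k).1 ≠ (p k).2 := by
          rintro k (hk | hk)
          · exact (h k).2.1 (Or.inl hk)
          · rw [ne_eq, hp ⟨a + t % (b + 1), by omega⟩ (by simp) (t / (b + 1) + 1) k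
              (by rw [hk]; exact hc) (by omega)]
            exact (h _).2.1 (Or.inr rfl)
        exact ⟨⟨⟨fun k hk => (h k).1 (by omega), fun k l hkl hk hl => (h2 k l hkl hk hl).1⟩, h3⟩,
          ⟨fun k hk => ((h k).1 (by omega)).symm, fun k l hkl hk hl => (h2 k l hkl hk hl).2⟩,
          fun k hk => (h3 k hk).symm⟩)
  rw [h]
  simp only [Finset.prod_range_add _ (a + (b + 1) + (t + 1)) r,
    Finset.prod_range_add _ (a + (b + 1)) (t + 1), Finset.prod_range_add _ a (b + 1)]
  rw [Finset.prod_congr rfl (g := fun _ => q) (fun k hk => by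
      have := Finset.mem_range.1 hk
      rw [if_pos (by omega)]),
    Finset.prod_congr (s₁ := Finset.range (b + 1)) rfl
      (g := fun k => if k = 0 ∨ k = t % (b + 1) then q * (q - 1) else q * q) (fun k hk => by
      have := Finset.mem_range.1 hk
      rw [if_neg (by omega), if_pos (by omega)]
      simp),
    Finset.prod_congr (s₁ := Finset.range (t + 1)) rfl (g := fun _ => 1) (fun k hk => by
      have := Finset.mem_range.1 hk
      rw [if_neg (by omega), if_neg (by omega)]),
    Finset.prod_congr (s₁ := Finset.range r) rfl (g := fun _ => q) (fun k hk => by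
      rw [if_pos (by omega)]),
    prod_range_ite_zero_or _ _ _ _ (Nat.mod_lt _ b.succ_pos)]
  simp only [Nat.dvd_iff_mod_eq_zero, Finset.prod_const, Finset.card_range, one_pow, mul_one,
    pow_add q a r]
  exact mul_right_comm _ _ _

/-! ### Splitting the pairs by first and last difference. -/

open Classical in
/-- The pairs consisting of a centre and a member of its ball. -/
noncomputable def ballPairs (q n b : ℕ) : Finset (Fin n → Fin q × Fin q) :=
  Finset.univ.filter fun p =>
    (fun k => (p k).2) ∈ burstLevenshteinBall b (fun k => (p k).1)

open Classical in
/-- The pairs with first difference `a`, last difference `c` and a shift in between, in one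
direction or the other. -/
noncomputable def biShiftPairs (q n b a c : ℕ) : Finset (Fin n → Fin q × Fin q) :=
  (Finset.univ.filter fun p => IsShiftPair b a c p) ∪
    Finset.univ.filter fun p => IsShiftPair b a c (Prod.swap ∘ p)

theorem sum_ncard_burstLevenshteinBall (q n b : ℕ) :
    ∑ x : Fin n → Fin q, (burstLevenshteinBall b x).ncard = (ballPairs q n b).card := by
  classical
  simp only [Set.ncard_eq_toFinset_card', ← Finset.card_sigma]
  refine Finset.card_nbij' (fun s k => (s.1 k, s.2 k))
    (fun p => ⟨fun k => (p k).1, fun k => (p k).2⟩) ?_ ?_ ?_ ?_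
  · intro s hs
    simpa [ballPairs] using hs
  · intro p hp
    simpa [ballPairs] using hp
  · intro s _
    rfl
  · intro p _
    rfl

theorem mem_biShiftPairs {q n b a c : ℕ} {p : Fin n → Fin q × Fin q} :
    p ∈ biShiftPairs q n b a c ↔
      (∀ k : Fin n, (k : ℕ) < a ∨ c + 1 ≤ k → (p k).1 = (p k).2) ∧
      (∀ k : Fin n, (k : ℕ) = a ∨ (k : ℕ) = c → (p k).1 ≠ (p k).2) ∧
      ((∀ k l : Fin n, (k : ℕ) + b = l → a ≤ k → (l : ℕ) < c + 1 → (p l).1 = (p k).2) ∨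
        ∀ k l : Fin n, (k : ℕ) + b = l → a ≤ k → (l : ℕ) < c + 1 → (p l).2 = (p k).1) := by
  classical
  rw [biShiftPairs, Finset.mem_union, Finset.mem_filter, Finset.mem_filter]
  simp only [IsShiftPair, BurstShift, Finset.mem_univ, true_and, Function.comp_apply,
    Prod.fst_swap, Prod.snd_swap]
  constructor
  · rintro (⟨⟨h1, h2⟩, h3⟩ | ⟨⟨h1, h2⟩, h3⟩)
    · exact ⟨h1, h3, Or.inl h2⟩
    · exact ⟨fun k hk => (h1 k hk).symm, fun k hk => (h3 k hk).symm, Or.inr h2⟩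
  · rintro ⟨h1, h3, h2 | h2⟩
    · exact Or.inl ⟨⟨h1, h2⟩, h3⟩
    · exact Or.inr ⟨⟨fun k hk => (h1 k hk).symm, h2⟩, fun k hk => (h3 k hk).symm⟩

theorem mem_windowPairs {q n b a : ℕ} {p : Fin n → Fin q × Fin q} :
    p ∈ windowPairs q n b a ↔
      (∀ k : Fin n, (k : ℕ) < a ∨ a + b ≤ k → (p k).1 = (p k).2) ∧
        ∀ k : Fin n, (k : ℕ) = a → (p k).1 ≠ (p k).2 := by
  rw [windowPairs, Finset.mem_filter]
  simp only [Finset.mem_univ, true_and, forall_and]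

theorem mem_prefixPairs {q n a : ℕ} {p : Fin n → Fin q × Fin q} :
    p ∈ prefixPairs q n a ↔ ∀ k : Fin n, (k : ℕ) < a → (p k).1 = (p k).2 := by
  rw [prefixPairs, Finset.mem_filter]
  simp only [Finset.mem_univ, true_and]

theorem mem_ballPairs {q n b : ℕ} {p : Fin n → Fin q × Fin q} :
    p ∈ ballPairs q n b ↔ ∃ i e, i + b ≤ e ∧ e ≤ n ∧
      (∀ k : Fin n, (k : ℕ) < i ∨ e ≤ k → (p k).1 = (p k).2) ∧
      ((∀ k l : Fin n, (k : ℕ) + b = l → i ≤ k → (l : ℕ) < e → (p l).1 = (p k).2) ∨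
        ∀ k l : Fin n, (k : ℕ) + b = l → i ≤ k → (l : ℕ) < e → (p l).2 = (p k).1) := by
  classical
  simp only [ballPairs, Finset.mem_filter, mem_burstLevenshteinBall_iff, BurstShift, Finset.mem_univ, true_and, and_or_left, eq_comm]

open Classical in
-- For `a < m` a block starting at the first difference `a` still fits. A pair without a difference
-- before `m`, equal sequences included, always lies in the ball, so these form one class.
theorem ballPairs_eq (q m b : ℕ) :
    ballPairs q (m + b) b = prefixPairs q (m + b) m ∪
      (Finset.range m).biUnion fun a => windowPairs q (m + b) b a ∪
        (Finset.range (m - a)).biUnion fun t => biShiftPairs q (m + b) b a (a + b + t) := by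
  ext p
  simp only [Finset.mem_union, Finset.mem_biUnion, Finset.mem_range, mem_windowPairs,
    mem_biShiftPairs, mem_prefixPairs, mem_ballPairs]
  constructor
  · rintro ⟨i, e, hie, he, h1, h2⟩
    by_cases hp : ∀ k : Fin (m + b), (k : ℕ) < m → (p k).1 = (p k).2
    · exact Or.inl hp
    right
    push Not at hp
    obtain ⟨k₀, hk₀, hk₀'⟩ := hp
    obtain ⟨D, hD⟩ : ∃ D : Finset (Fin (m + b)), ∀ k, k ∈ D ↔ (p k).1 ≠ (p k).2 :=
      ⟨Finset.univ.filter fun k => (p k).1 ≠ (p k).2, by simp⟩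
    have hne : D.Nonempty := ⟨k₀, (hD _).2 hk₀'⟩
    obtain ⟨a, ha, hamin⟩ : ∃ a : Fin (m + b), (p a).1 ≠ (p a).2 ∧
        ∀ k : Fin (m + b), (p k).1 ≠ (p k).2 → (a : ℕ) ≤ k :=
      ⟨D.min' hne, (hD _).1 (D.min'_mem hne), fun k hk => D.min'_le k ((hD k).2 hk)⟩
    obtain ⟨c, hc, hcmax⟩ : ∃ c : Fin (m + b), (p c).1 ≠ (p c).2 ∧
        ∀ k : Fin (m + b), (p k).1 ≠ (p k).2 → (k : ℕ) ≤ c :=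
      ⟨D.max' hne, (hD _).1 (D.max'_mem hne), fun k hk => D.le_max' k ((hD k).2 hk)⟩
    have ham := hamin k₀ hk₀'
    have h3 : ∀ k : Fin (m + b), (k : ℕ) < a ∨ (c : ℕ) < k → (p k).1 = (p k).2 := by
      intro k hk
      by_contra h
      have := hamin k h
      have := hcmax k h
      omega
    refine ⟨a, by omega, ?_⟩
    by_cases hac : (c : ℕ) < a + b
    · left
      refine ⟨fun k hk => h3 k (by omega), fun k hk => ?_⟩
      obtain rfl : k = a := Fin.ext hk
      exact ha
    · right
      -- The sequences agree outside `[i, e)`, so both extreme differences lie inside it and the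
      -- shift restricts to the smaller window.
      have hia : i ≤ a := by
        by_contra h
        exact ha (h1 a (by omega))
      have hce : (c : ℕ) < e := by
        by_contra h
        exact hc (h1 c (by omega))
      refine ⟨c - (a + b), by omega, ?_⟩
      rw [show (a : ℕ) + b + (c - (a + b)) = c by omega]
      refine ⟨fun k hk => h3 k (by omega), ?_, ?_⟩
      · rintro k (hk | hk)
        · obtain rfl : k = a := Fin.ext hk
          exact ha
        · obtain rfl : k = c := Fin.ext hk
          exact hc
      · rcases h2 with h2 | h2
        · exact Or.inl fun k l hkl hk hl => h2 k l hkl (by omega) (by omega)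
        · exact Or.inr fun k l hkl hk hl => h2 k l hkl (by omega) (by omega)
  · rintro (h | ⟨a, ha, h | ⟨t, ht, h1, _, h3⟩⟩)
    -- In a window of length exactly `b` the shift condition is vacuous.
    · exact ⟨m, m + b, le_rfl, le_rfl, fun k hk => h k (by omega), Or.inl fun k l _ _ _ => by omega⟩
    · exact ⟨a, a + b, le_rfl, by omega, h.1, Or.inl fun k l _ _ _ => by omega⟩
    · exact ⟨a, a + b + t + 1, by omega, by omega, h1, h3⟩

theorem card_ballPairs (q m b : ℕ) :
    (ballPairs q (m + b) b).card = (prefixPairs q (m + b) m).card +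
      ∑ a ∈ Finset.range m, ((windowPairs q (m + b) b a).card +
        ∑ t ∈ Finset.range (m - a), (biShiftPairs q (m + b) b a (a + b + t)).card) := by
  classical
  rw [ballPairs_eq, Finset.card_union_of_disjoint, Finset.card_biUnion]
  · congr 1
    refine Finset.sum_congr rfl fun a ha => ?_
    rw [Finset.mem_range] at ha
    rw [Finset.card_union_of_disjoint, Finset.card_biUnion]
    · intro t ht t' ht' hne
      rw [Finset.mem_coe, Finset.mem_range] at ht ht'
      rw [Function.onFun, Finset.disjoint_left]
      intro p hp hp'
      rw [mem_biShiftPairs] at hp hp'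
      rcases lt_or_gt_of_ne hne with h | h
      · exact hp'.2.1 ⟨a + b + t', by omega⟩ (by simp) (hp.1 _ (by simp; omega))
      · exact hp.2.1 ⟨a + b + t, by omega⟩ (by simp) (hp'.1 _ (by simp; omega))
    · rw [Finset.disjoint_left]
      intro p hp hp'
      simp only [Finset.mem_biUnion, Finset.mem_range, mem_biShiftPairs, mem_windowPairs] at hp hp'
      obtain ⟨t, ht, h⟩ := hp'
      exact h.2.1 ⟨a + b + t, by omega⟩ (by simp) (hp.1 _ (by simp))
  · intro a ha a' ha' hne
    rw [Finset.mem_coe, Finset.mem_range] at ha ha'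
    have key : ∀ a p, a < m → (p ∈ windowPairs q (m + b) b a ∪ (Finset.range (m - a)).biUnion
        fun t => biShiftPairs q (m + b) b a (a + b + t)) →
        (∀ k : Fin (m + b), (k : ℕ) < a → (p k).1 = (p k).2) ∧
        ∀ k : Fin (m + b), (k : ℕ) = a → (p k).1 ≠ (p k).2 := by
      intro a p _ hp
      simp only [Finset.mem_union, Finset.mem_biUnion, Finset.mem_range, mem_biShiftPairs,
        mem_windowPairs] at hp
      rcases hp with h | ⟨t, _, h⟩
      · exact ⟨fun k hk => h.1 k (Or.inl hk), h.2⟩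
      · exact ⟨fun k hk => h.1 k (Or.inl hk), fun k hk => h.2.1 k (Or.inl hk)⟩
    rw [Function.onFun, Finset.disjoint_left]
    intro p hp hp'
    have h1 := key a p ha hp
    have h2 := key a' p ha' hp'
    rcases lt_or_gt_of_ne hne with h | h
    · exact h1.2 ⟨a, by omega⟩ rfl (h2.1 _ h)
    · exact h2.2 ⟨a', by omega⟩ rfl (h1.1 _ h)
  · rw [Finset.disjoint_left]
    intro p hp hp'
    simp only [Finset.mem_union, Finset.mem_biUnion, Finset.mem_range, mem_biShiftPairs,
      mem_windowPairs, mem_prefixPairs] at hp hp'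
    obtain ⟨a, ha, h | ⟨t, _, h⟩⟩ := hp'
    · exact h.2 ⟨a, by omega⟩ rfl (hp _ ha)
    · exact h.2.1 ⟨a, by omega⟩ (Or.inl rfl) (hp _ ha)

open Classical in
-- Inclusion-exclusion; exchanging the two sequences is a bijection between the two directions.
theorem card_biShiftPairs_add (q n b a c : ℕ) :
    (biShiftPairs q n b a c).card + (Finset.univ.filter fun p : Fin n → Fin q × Fin q =>
        IsShiftPair b a c p ∧ IsShiftPair b a c (Prod.swap ∘ p)).card =
      2 * (Finset.univ.filter fun p : Fin n → Fin q × Fin q => IsShiftPair b a c p).card := by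
  have h : (Finset.univ.filter fun p : Fin n → Fin q × Fin q =>
      IsShiftPair b a c (Prod.swap ∘ p)).card =
      (Finset.univ.filter fun p : Fin n → Fin q × Fin q => IsShiftPair b a c p).card := by
    refine Finset.card_nbij' (fun p => Prod.swap ∘ p) (fun p => Prod.swap ∘ p) ?_ ?_ ?_ ?_
    · intro p hp
      simpa using hp
    · intro p hp
      simpa [← Function.comp_assoc] using hp
    · intro p _
      simp [← Function.comp_assoc]
    · intro p _
      simp [← Function.comp_assoc]
  rw [biShiftPairs, Finset.filter_and, Finset.card_union_add_card_inter, h, two_mul]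

/-! ### The expectation as a sum over the distance of the extreme differences. -/

/-- The proportion of pairs with given first and last differences `b + t` apart that are shifts
in both directions. -/
noncomputable def swapDensity (q b t : ℕ) : ℝ :=
  (if b ∣ t then ((q : ℝ) - 1) * (q : ℝ) ^ (2 * b - 1)
    else ((q : ℝ) - 1) ^ 2 * (q : ℝ) ^ (2 * b - 2)) / (q : ℝ) ^ (b + t + 1)

/-- A given `t` occurs for the `m - t` starting points `a < m - t`. -/
theorem sum_range_sum_range_sub (m : ℕ) (f : ℕ → ℝ) :
    ∑ a ∈ Finset.range m, ∑ t ∈ Finset.range (m - a), f t =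
      ∑ t ∈ Finset.range m, ((m : ℝ) - t) * f t := by
  rw [Finset.sum_comm' (t' := Finset.range m) (s' := fun t => Finset.range (m - t))
    (by intro x y; simp only [Finset.mem_range]; omega)]
  refine Finset.sum_congr rfl fun t ht => ?_
  rw [Finset.mem_range] at ht
  rw [Finset.sum_const, Finset.card_range, nsmul_eq_mul, Nat.cast_sub ht.le]

theorem sum_range_sub_const (m : ℕ) (c : ℝ) :
    ∑ t ∈ Finset.range m, ((m : ℝ) - t) * (2 * c) = m * (m + 1) * c := by
  rw [← sum_range_sum_range_sub]
  induction m with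
  | zero => simp
  | succ m ih =>
    rw [Finset.sum_range_succ']
    simp only [Nat.add_sub_add_right, ih]
    simp
    ring

theorem card_windowPairs_cast {q m b a : ℕ} (hq : 1 ≤ q) (hb : 1 ≤ b) (ha : a < m) :
    ((windowPairs q (m + b) b a).card : ℝ) =
      (q : ℝ) ^ (m + b) * ((q : ℝ) ^ (b - 1) * ((q : ℝ) - 1)) := by
  obtain ⟨b, rfl⟩ : ∃ b', b = b' + 1 := ⟨b - 1, by omega⟩
  obtain ⟨r, rfl⟩ : ∃ r, m = a + r := ⟨m - a, by omega⟩
  rw [show a + r + (b + 1) = a + (b + 1) + r by ring, card_windowPairs]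
  push_cast [Nat.cast_sub hq]
  simp

theorem card_biShiftPairs_cast {q m b a t : ℕ} (hq : 1 ≤ q) (hb : 1 ≤ b) (ha : a + t < m) :
    ((biShiftPairs q (m + b) b a (a + b + t)).card : ℝ) =
      (q : ℝ) ^ (m + b) * (2 * ((q : ℝ) ^ ((b : ℤ) - 2) * ((q : ℝ) - 1) ^ 2) -
        swapDensity q b t) := by
  obtain ⟨b, rfl⟩ : ∃ b', b = b' + 1 := ⟨b - 1, by omega⟩
  obtain ⟨r, rfl⟩ : ∃ r, m = a + (t + 1) + r := ⟨m - (a + (t + 1)), by omega⟩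
  have h := card_biShiftPairs_add q (a + (b + 1) + (t + 1) + r) (b + 1) a (a + (b + 1) + t)
  rw [card_shiftPairs, card_swapPairs, ← Nat.cast_inj (R := ℝ)] at h
  rw [show a + (t + 1) + r + (b + 1) = a + (b + 1) + (t + 1) + r by ring]
  have hQ : (q : ℝ) ≠ 0 := by positivity
  have h1 : ((if b + 1 ∣ t then q * (q - 1) * (q * q) ^ b else
      (q * (q - 1)) ^ 2 * (q * q) ^ (b - 1) : ℕ) : ℝ) =
      swapDensity q (b + 1) t * (q : ℝ) ^ (b + 1 + t + 1) := by
    rw [swapDensity, div_mul_cancel₀ _ (pow_ne_zero _ hQ)]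
    split_ifs with hd
    · push_cast [Nat.cast_sub hq]
      rw [show 2 * (b + 1) - 1 = 2 * b + 1 by omega]
      ring
    -- Block length `1` divides every `t`, so here the block has length at least `2` and the
    -- truncated exponent `b - 1` is genuine.
    · obtain ⟨s, rfl⟩ : ∃ s, b = s + 1 := by
        refine ⟨b - 1, ?_⟩
        rcases b with _ | b
        · simp at hd
        · simp
      push_cast [Nat.cast_sub hq]
      rw [show 2 * (s + 1 + 1) - 2 = 2 * s + 2 by omega]
      ring
  have h2 : (q : ℝ) ^ (((b + 1 : ℕ) : ℤ) - 2) = (q : ℝ) ^ b / q := by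
    rw [show ((b + 1 : ℕ) : ℤ) - 2 = b - 1 by push_cast; ring, zpow_sub₀ hQ]
    simp
  rw [Nat.cast_add, Nat.cast_mul (q ^ (a + r)), h1] at h
  rw [h2]
  push_cast [Nat.cast_sub hq] at h
  rw [eq_sub_of_add_eq h]
  field_simp
  ring

/-- The summands are, in order, the pairs differing only in the last `b` places, those with
differences within one block, and the two shift directions minus their overlap. The integer exponent
`b - 2` is negative for `b = 1`. -/
theorem expectedBallSize_eq (q m b : ℕ) (hq : 1 ≤ q) (hb : 1 ≤ b) :
    expectedBallSize q b (m + b) = (q : ℝ) ^ b + m * ((q : ℝ) ^ (b - 1) * ((q : ℝ) - 1)) +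
      m * (m + 1) * ((q : ℝ) ^ ((b : ℤ) - 2) * ((q : ℝ) - 1) ^ 2) -
      ∑ t ∈ Finset.range m, ((m : ℝ) - t) * swapDensity q b t := by
  have hQ : (q : ℝ) ≠ 0 := by positivity
  rw [expectedBallSize, ← Nat.cast_sum, sum_ncard_burstLevenshteinBall, card_ballPairs,
    card_prefixPairs, div_eq_iff (pow_ne_zero _ hQ)]
  push_cast
  have h : ∀ a ∈ Finset.range m, ((windowPairs q (m + b) b a).card : ℝ) +
      ∑ t ∈ Finset.range (m - a), ((biShiftPairs q (m + b) b a (a + b + t)).card : ℝ) =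
      (q : ℝ) ^ (m + b) * ((q : ℝ) ^ (b - 1) * ((q : ℝ) - 1) + ∑ t ∈ Finset.range (m - a),
        (2 * ((q : ℝ) ^ ((b : ℤ) - 2) * ((q : ℝ) - 1) ^ 2) - swapDensity q b t)) := by
    intro a ha
    rw [Finset.mem_range] at ha
    rw [card_windowPairs_cast hq hb ha, Finset.sum_congr rfl fun t ht =>
      card_biShiftPairs_cast hq hb (by rw [Finset.mem_range] at ht; omega), ← Finset.mul_sum,
      ← mul_add]
  rw [Finset.sum_congr rfl h]
  rw [← Finset.mul_sum, Finset.sum_add_distrib, sum_range_sum_range_sub]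
  simp only [mul_sub, Finset.sum_sub_distrib, Finset.sum_const, Finset.card_range, nsmul_eq_mul]
  simp only [← mul_sub]
  rw [sum_range_sub_const]
  ring

/-- Substitute `i = a + 1` and `j = i + b + t`: the stated double sum is the part of the correction
at distances `j - i ≥ b`. -/
theorem sum_pairWeight_eq (q b s : ℕ) :
    ∑ i ∈ Finset.Icc 1 s, ∑ j ∈ Finset.Icc (i + b) (s + b),
        pairWeight q b i j / (q : ℝ) ^ (j + b - i + 1) =
      ∑ t ∈ Finset.range s, ((s : ℝ) - t) * swapDensity q b (b + t) := by
  rw [← sum_range_sum_range_sub]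
  refine Finset.sum_nbij' (fun i => i - 1) (fun a => a + 1) ?_ ?_ ?_ ?_ ?_
  · intro i hi
    simp at hi ⊢
    omega
  · intro a ha
    simp at ha ⊢
    omega
  · intro i hi
    simp at hi ⊢
    omega
  · intro a _
    simp
  · intro i hi
    rw [Finset.mem_Icc] at hi
    refine Finset.sum_nbij' (fun j => j - (i + b)) (fun t => t + (i + b)) ?_ ?_ ?_ ?_ ?_
    · intro j hj
      simp at hj ⊢
      omega
    · intro t ht
      simp at ht ⊢
      omega
    · intro j hj
      simp at hj ⊢
      omega
    · intro t _
      simp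
    · intro j hj
      rw [Finset.mem_Icc] at hj
      rw [pairWeight, swapDensity, show j - i = b + (j - (i + b)) by omega,
        show j + b - i + 1 = b + (b + (j - (i + b))) + 1 by omega]

/-! ### Bounding and evaluating the correction sum. -/

theorem swapDensity_nonneg {q b t : ℕ} (hq : 1 ≤ q) : 0 ≤ swapDensity q b t := by
  have hQ : (0 : ℝ) ≤ (q : ℝ) - 1 := by
    rw [sub_nonneg]
    exact_mod_cast hq
  rw [swapDensity]
  split_ifs <;> positivity

theorem swapDensity_le {q b t : ℕ} (hq : 1 ≤ q) (hb : 1 ≤ b) :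
    swapDensity q b t ≤ (q : ℝ) ^ b * (((q : ℝ) - 1) / (q : ℝ) ^ (t + 1)) := by
  have hQ1 : (1 : ℝ) ≤ q := by exact_mod_cast hq
  have hQ : (0 : ℝ) ≤ (q : ℝ) - 1 := by linarith
  have h : (q : ℝ) ^ b * (((q : ℝ) - 1) / (q : ℝ) ^ (t + 1)) =
      ((q : ℝ) - 1) * (q : ℝ) ^ (2 * b) / (q : ℝ) ^ (b + t + 1) := by
    field_simp
    ring
  rw [h, swapDensity]
  gcongr
  split_ifs
  · gcongr
    omega
  · rw [pow_two, mul_assoc]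
    gcongr
    calc ((q : ℝ) - 1) * (q : ℝ) ^ (2 * b - 2) ≤ q * (q : ℝ) ^ (2 * b - 2) := by
          gcongr
          linarith
      _ = (q : ℝ) ^ (2 * b - 2 + 1) := by ring
      _ ≤ (q : ℝ) ^ (2 * b) := by
          gcongr
          omega

/-- The sum telescopes; keeping the factor `q - 1` in the numerator includes `q = 1`. -/
theorem sum_sub_one_div_pow {q : ℕ} (hq : 1 ≤ q) (m : ℕ) :
    ∑ t ∈ Finset.range m, ((q : ℝ) - 1) / (q : ℝ) ^ (t + 1) = 1 - 1 / (q : ℝ) ^ m := by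
  have hQ : (q : ℝ) ≠ 0 := by positivity
  induction m with
  | zero => simp
  | succ m ih =>
    rw [Finset.sum_range_succ, ih]
    field_simp
    ring

theorem sum_swapDensity_le {q b : ℕ} (hq : 1 ≤ q) (hb : 1 ≤ b) (m : ℕ) :
    ∑ t ∈ Finset.range m, ((m : ℝ) - t) * swapDensity q b t ≤ m * (q : ℝ) ^ b := by
  calc ∑ t ∈ Finset.range m, ((m : ℝ) - t) * swapDensity q b t
      ≤ ∑ t ∈ Finset.range m, m * ((q : ℝ) ^ b * (((q : ℝ) - 1) / (q : ℝ) ^ (t + 1))) := by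
        refine Finset.sum_le_sum fun t _ => ?_
        refine mul_le_mul ?_ (swapDensity_le hq hb) (swapDensity_nonneg hq) (by positivity)
        have : (0 : ℝ) ≤ t := by positivity
        linarith
    _ = m * ((q : ℝ) ^ b * (1 - 1 / (q : ℝ) ^ m)) := by
        rw [← Finset.mul_sum, ← Finset.mul_sum, sum_sub_one_div_pow hq]
    _ ≤ m * (q : ℝ) ^ b := by
        gcongr
        have : (0 : ℝ) ≤ 1 / (q : ℝ) ^ m := by positivity
        exact mul_le_of_le_one_right (by positivity) (by linarith)

theorem sum_swapDensity_nonneg {q b : ℕ} (hq : 1 ≤ q) (m : ℕ) :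
    0 ≤ ∑ t ∈ Finset.range m, ((m : ℝ) - t) * swapDensity q b t := by
  refine Finset.sum_nonneg fun t ht => mul_nonneg ?_ (swapDensity_nonneg hq)
  rw [Finset.mem_range] at ht
  rw [sub_nonneg]
  exact_mod_cast ht.le

/-- The term `t = 0` is divisible by `b` and stands alone, `0 < t < b` is never divisible and gives
the single sum, and `t ≥ b` remains as it is. -/
theorem sum_swapDensity_eq {q b : ℕ} (hq : 1 ≤ q) (hb : 1 ≤ b) (s : ℕ) :
    ∑ t ∈ Finset.range (s + b), (((s + b : ℕ) : ℝ) - t) * swapDensity q b t =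
      ((s : ℝ) + b) * ((q : ℝ) ^ ((b : ℤ) - 2) * ((q : ℝ) - 1)) +
      ∑ j ∈ Finset.Icc 1 (b - 1),
        (q : ℝ) ^ b * ((q : ℝ) - 1) ^ 2 * ((s : ℝ) + b - j) / (q : ℝ) ^ (j + 3) +
      ∑ t ∈ Finset.range s, ((s : ℝ) - t) * swapDensity q b (b + t) := by
  have hQ : (q : ℝ) ≠ 0 := by positivity
  rw [add_comm s b, Finset.sum_range_add]
  congr 1
  · rw [Finset.range_eq_Ico, Finset.sum_eq_sum_Ico_succ_bot (by omega),
      show Finset.Icc 1 (b - 1) = Finset.Ico (0 + 1) b by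
        ext j; simp only [Finset.mem_Icc, Finset.mem_Ico]; omega]
    congr 1
    · rw [zpow_sub₀ hQ, swapDensity, if_pos (dvd_zero b)]
      obtain ⟨b, rfl⟩ : ∃ b', b = b' + 1 := ⟨b - 1, by omega⟩
      rw [show 2 * (b + 1) - 1 = 2 * b + 1 by omega, zpow_natCast]
      rw [show (q : ℝ) ^ (2 : ℤ) = (q : ℝ) ^ 2 from zpow_natCast _ 2]
      push_cast
      field_simp
      ring
    · refine Finset.sum_congr rfl fun j hj => ?_
      rw [Finset.mem_Ico] at hj
      rw [swapDensity, if_neg (fun h => by have := Nat.le_of_dvd (by omega) h; omega)]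
      obtain ⟨b, rfl⟩ : ∃ b', b = b' + 2 := ⟨b - 2, by omega⟩
      rw [show 2 * (b + 2) - 2 = 2 * b + 2 by omega]
      push_cast
      field_simp
      ring
  · refine Finset.sum_congr rfl fun t _ => ?_
    push_cast
    ring

/-! ### The exact formula and the asymptotics. -/

theorem theorem4 (q b : ℕ) (hq : 1 ≤ q) (hb : 1 ≤ b) :
    (∀ n : ℕ, 2 * b + 1 ≤ n →
      expectedBallSize q b n =
        (q : ℝ) ^ ((b : ℤ) - 2) * ((q : ℝ) + ((q : ℝ) - 1) * ((n : ℝ) - b))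
            * (((n : ℝ) - b + 1) * ((q : ℝ) - 1) - 1)
          + 2 * (q : ℝ) ^ (b - 1)
          - ∑ j ∈ Finset.Icc 1 (b - 1),
              (q : ℝ) ^ b * ((q : ℝ) - 1) ^ 2 * ((n : ℝ) - b - j) / (q : ℝ) ^ (j + 3)
          - ∑ i ∈ Finset.Icc 1 (n - 2 * b), ∑ j ∈ Finset.Icc (i + b) (n - b),
              pairWeight q b i j / (q : ℝ) ^ (j + b - i + 1)) ∧
    (∃ C : ℝ, ∀ n : ℕ, 2 * b + 1 ≤ n →
      |expectedBallSize q b n - (q : ℝ) ^ ((b : ℤ) - 2) * ((q : ℝ) - 1) ^ 2 * (n : ℝ) ^ 2|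
        ≤ C * (n : ℝ)) := by
  have hQ : (q : ℝ) ≠ 0 := by positivity
  have hQ1 : (1 : ℝ) ≤ q := by exact_mod_cast hq
  have hQ0 : (0 : ℝ) ≤ (q : ℝ) - 1 := by linarith
  refine ⟨fun n hn => ?_, ?_⟩
  · obtain ⟨s, rfl⟩ : ∃ s, n = s + b + b := ⟨n - 2 * b, by omega⟩
    rw [expectedBallSize_eq q (s + b) b hq hb, sum_swapDensity_eq hq hb, ← sum_pairWeight_eq,
      show s + b + b - 2 * b = s by omega, show s + b + b - b = s + b by omega]
    have h1 : (q : ℝ) ^ (b - 1) = (q : ℝ) ^ ((b : ℤ) - 2) * q := by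
      rw [← zpow_natCast, ← zpow_add_one₀ hQ, Nat.cast_sub hb]
      congr 1
      push_cast
      ring
    have h2 : (q : ℝ) ^ b = (q : ℝ) ^ ((b : ℤ) - 2) * q * q := by
      rw [← h1, ← pow_succ, Nat.sub_add_cancel hb]
    have h3 : (((s + b + b : ℕ) : ℝ)) - b = s + b := by
      push_cast
      ring
    rw [h3, ← sub_sub, ← sub_sub]
    -- The single and double sums cancel; what remains is a polynomial identity once the powers of
    -- `q` are written as multiples of `q ^ (b - 2)`.
    congr 2
    rw [h1, h2]
    push_cast
    ring
  · set A := (q : ℝ) ^ ((b : ℤ) - 2) * ((q : ℝ) - 1) ^ 2 with hA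
    have hA0 : 0 ≤ A := by positivity
    set D := (q : ℝ) ^ (b - 1) * ((q : ℝ) - 1) with hD
    have hD0 : 0 ≤ D := by positivity
    -- The four terms of the constant bound, in order, the constant `q ^ b`, the linear term `m *
    -- D`, the remainder `A * (m - 2 * m * b - b ^ 2)` left after subtracting `A * n ^ 2`, and the
    -- correction sum.
    refine ⟨(q : ℝ) ^ b + D + A * (2 * b + 1) ^ 2 + (q : ℝ) ^ b, fun n hn => ?_⟩
    obtain ⟨m, rfl⟩ : ∃ m, n = m + b := ⟨n - b, by omega⟩
    rw [expectedBallSize_eq q m b hq hb, ← hA, ← hD]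
    have h1 := sum_swapDensity_le hq hb m
    have h2 := sum_swapDensity_nonneg (b := b) hq m
    set S := ∑ t ∈ Finset.range m, ((m : ℝ) - t) * swapDensity q b t
    have hE : (0 : ℝ) ≤ (q : ℝ) ^ b := by positivity
    set E := (q : ℝ) ^ b
    have hm : (1 : ℝ) ≤ m := by exact_mod_cast (by omega : 1 ≤ m)
    have hb' : (1 : ℝ) ≤ b := by exact_mod_cast hb
    push_cast
    have e1 : E + m * D + m * (m + 1) * A - S - A * ((m : ℝ) + b) ^ 2 =
        E + m * D - S + A * (m - 2 * m * b - b ^ 2) := by ring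
    rw [e1, abs_le]
    have e2 : A * (m - 2 * m * b - b ^ 2) ≤ A * ((2 * b + 1) ^ 2 * (m + b)) := by
      gcongr
      nlinarith
    have e3 : A * (-((2 * b + 1) ^ 2 * (m + b))) ≤ A * (m - 2 * m * b - b ^ 2) := by
      gcongr
      nlinarith
    have e4 : 0 ≤ E * (m + b - 1) := mul_nonneg hE (by linarith)
    have e5 : 0 ≤ D * b := by positivity
    have e6 : 0 ≤ E * b := by positivity
    have e7 : 0 ≤ m * D := by positivity
    constructor <;> nlinarith
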